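/- Let $N\ge m$, $\mathbf H\in\mathbb R^{N\times m}$ with rows $\mathbf h_1^\top,\dots,\mathbf h_N^\top$, and $\mathbf z=(z_1,\dots,z_N)^\top\in\mathbb R^N$ (no assumption is made on the rank of $\mathbf H$). Put $f(\mathbf y)=\|\mathbf z-\mathbf H\mathbf y\|^2=\sum_{i=1}^N f_i(\mathbf y)$ with $f_i(\mathbf y)=|\mathbf h_i^\top\mathbf y-z_i|^2$, and let $\mathcal Y_{\rm LS}=\operatorname{argmin}_{\mathbf y\in\mathbb R^m} f(\mathbf y)$ be the set of least-squares solutions of $\mathbf z=\mathbf H\mathbf y$. Let $\mathcal Q^*$ be a set of undirected simple graphs on $\mathcal V=\{1,\dots,N\}$, all of which are connected, and let every edge $\{i,j\}$ of a graph in $\mathcal Q^*$ carry a fixed weight $w(\{i,j\})>0$. Let $\mathcal G:[0,\infty)\to\mathcal Q^*$, $t\mapsto\mathcal G(t)$, be piecewise constant, in the sense that the set of times at which $\mathcal G$ is discontinuous (not locally constant) has Lebesgue measure zero. Let $\mathcal N_i(t)$ be the set of neighbours of $i$ in $\mathcal G(t)$. Let $K>0$ and let $\alpha:[0,\infty)\to(0,\infty)$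 be continuous with (i) $\int_0^\infty\alpha(t)\,dt=\infty$, (ii) $\lim_{t\to\infty}\alpha(t)=0$, (iii) $\int_0^\infty\alpha(t)^2\,dt<\infty$. Then for every (Carathéodory) solution $\mathbf x_1,\dots,\mathbf x_N:[0,\infty)\to\mathbb R^m$ of $$\dot{\mathbf x}_i(t)=K\sum_{j\in\mathcal N_i(t)}w(\{i,j\})\,(\mathbf x_j(t)-\mathbf x_i(t))-\frac{\alpha(t)}2\nabla f_i(\mathbf x_i(t)),\qquad i=1,\dots,N,$$ that is, locally absolutely continuous functions which satisfy the equations for almost every $t\ge0$, there is $\hat{\mathbf y}\in\mathcal Y_{\rm LS}$ (possibly depending on the solution) such that $$\lim_{t\to\infty}\mathbf x_i(t)=\hat{\mathbf y}\qquad\text{for all } i=1,\dots,N.$$ Moreover, $|\mathcal Y_{\rm LS}|=1$ if $\operatorname{rank}(\mathbf H)=m$. -/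

import Mathlib

open Set Filter Topology MeasureTheory

namespace NetworkLS

/-- The `i`-th row `hᵢ` of `H`, as a vector of the Euclidean space `ℝᵐ`. -/
def row {N m : ℕ} (H : Matrix (Fin N) (Fin m) ℝ) (i : Fin N) : EuclideanSpace ℝ (Fin m) :=
  WithLp.toLp 2 (H i)

/-- The least-squares cost `f(y) = ‖z - H y‖²` (Euclidean norm). -/
noncomputable def cost {N m : ℕ} (H : Matrix (Fin N) (Fin m) ℝ) (z : EuclideanSpace ℝ (Fin N))
    (y : EuclideanSpace ℝ (Fin m)) : ℝ :=
  ‖z - WithLp.toLp 2 (H.mulVec y.ofLp)‖ ^ 2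

/-- The local cost `fᵢ(y) = |hᵢᵀ y - zᵢ|²` of node `i`. -/
noncomputable def localCost {N m : ℕ} (H : Matrix (Fin N) (Fin m) ℝ)
    (z : EuclideanSpace ℝ (Fin N)) (i : Fin N) (y : EuclideanSpace ℝ (Fin m)) : ℝ :=
  |inner ℝ (row H i) y - z i| ^ 2

/-- The set `argmin f` of least-squares solutions of `z = H y`. -/
def leastSquaresSolutions {N m : ℕ} (H : Matrix (Fin N) (Fin m) ℝ)
    (z : EuclideanSpace ℝ (Fin N)) : Set (EuclideanSpace ℝ (Fin m)) :=
  {y | IsMinOn (cost H z) univ y}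

open Classical in
/-- The weighted adjacency matrix of a simple graph `G` with edge weights `w`. -/
noncomputable def adjacency {N : ℕ} (w : Sym2 (Fin N) → ℝ) (G : SimpleGraph (Fin N)) :
    Matrix (Fin N) (Fin N) ℝ :=
  Matrix.of fun i j => if G.Adj i j then w s(i, j) else 0

/-- `G : [0, ∞) → graphs` is piecewise constant: the set of its discontinuities, that is, of
the times in `[0, ∞)` near which it is not constant, has Lebesgue measure zero.
(Values at negative times are irrelevant.) -/
def PiecewiseConstant {N : ℕ} (G : ℝ → SimpleGraph (Fin N)) : Prop :=
  volume {t : ℝ | 0 ≤ t ∧ ¬ ∀ᶠ s in 𝓝[Ici 0] t, G s = G t} = 0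

open Classical in
/-- The right-hand side of the flow at node `i`, for the graph `G` and the step size `a`:
`K ∑_{j ∈ Nᵢ} A_{ij} (xⱼ - xᵢ) - (a / 2) ∇fᵢ(xᵢ)`. -/
noncomputable def flowField {N m : ℕ} (H : Matrix (Fin N) (Fin m) ℝ)
    (z : EuclideanSpace ℝ (Fin N)) (w : Sym2 (Fin N) → ℝ) (K : ℝ) (G : SimpleGraph (Fin N))
    (a : ℝ) (x : Fin N → EuclideanSpace ℝ (Fin m)) (i : Fin N) : EuclideanSpace ℝ (Fin m) :=
  K • (∑ j ∈ G.neighborFinset i, adjacency w G i j • (x j - x i))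
    - (a / 2) • gradient (localCost H z i) (x i)

/-- `x = (x₁, …, x_N)` is a (Carathéodory) solution on `[0, ∞)` of the flow over the switching
graph `G` with step size `α`: every `xᵢ` is absolutely continuous on every `[0, T]` and the
differential equation holds at almost every `t ≥ 0`. -/
structure IsFlowSolution {N m : ℕ} (H : Matrix (Fin N) (Fin m) ℝ)
    (z : EuclideanSpace ℝ (Fin N)) (w : Sym2 (Fin N) → ℝ) (K : ℝ) (G : ℝ → SimpleGraph (Fin N))
    (α : ℝ → ℝ) (x : Fin N → ℝ → EuclideanSpace ℝ (Fin m)) : Prop where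
  absolutelyContinuous : ∀ i, ∀ T, 0 ≤ T → AbsolutelyContinuousOnInterval (x i) 0 T
  hasDerivAt : ∀ i, ∀ᵐ t ∂(volume.restrict (Ici (0 : ℝ))),
    HasDerivAt (x i) (flowField H z w K (G t) (α t) (fun j => x j t) i) t

end NetworkLS

/-! Fix `y` with `Hᵀ (H y - z) = 0` and let `V = ∑ ‖xᵢ - y‖²`. The coupling decreases `V` at a rate
at least `K c ∑ ‖xᵢ - xₖ‖²`, with one `c > 0` for all graphs (`exists_uniform_spectral_gap`). The
gradients contribute `-2α ∑ ⟨hᵢ, xᵢ - y⟩²` and a cross term; the normal equations make the latter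
linear in the disagreement, so half of the coupling absorbs it at a cost `B α²`
(`sum_inner_flowField_le`). As `α²` is integrable, `V` converges; as `∫ α = ∞`, disagreement and
excess cost are jointly small at arbitrarily late times (`dissipation`). By compactness the
trajectory then has a limit point with all components equal to some `v`, again a solution of the
normal equations. The energy based at `v` converges too, and tends to `0` along a subsequence, hence
to `0`. -/

/-! ### Dissipation inequalities -/

theorem AbsolutelyContinuousOnInterval.sub_le_integral_of_deriv_le {V k : ℝ → ℝ} {a b : ℝ}
    (hab : a ≤ b) (hV : AbsolutelyContinuousOnInterval V a b)
    (hk : IntervalIntegrable k volume a b)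
    (hle : ∀ᵐ t, t ∈ Icc a b → ∃ v, HasDerivAt V v t ∧ v ≤ k t) :
    V b - V a ≤ ∫ t in a..b, k t := by
  rw [← hV.integral_deriv_eq_sub]
  refine intervalIntegral.integral_mono_ae_restrict hab hV.intervalIntegrable_deriv hk ?_
  refine (ae_restrict_iff' measurableSet_Icc).2 ?_
  filter_upwards [hle] with t ht htm
  obtain ⟨v, hv, hvk⟩ := ht htm
  rwa [hv.deriv]

/-- A nonnegative energy that dissipates at rate `c α ψ`, up to a perturbation `B α²` with finite
total mass, converges, and `ψ` is arbitrarily small at arbitrarily late times if `∫ α = ∞`. -/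
theorem dissipation {V ψ α : ℝ → ℝ} {c B T₀ : ℝ} (hc : 0 < c) (hB : 0 ≤ B) (hT₀ : 0 ≤ T₀)
    (hαcont : ContinuousOn α (Ici 0)) (hαpos : ∀ t, 0 ≤ t → 0 < α t)
    (hαint : Tendsto (fun T : ℝ => ∫ t in (0 : ℝ)..T, α t) atTop atTop)
    (hαsq : IntegrableOn (fun t => α t ^ 2) (Ici 0))
    (hV0 : ∀ t, 0 ≤ V t) (hψ0 : ∀ t, 0 ≤ ψ t)
    (hV : ∀ T, 0 ≤ T → AbsolutelyContinuousOnInterval V 0 T)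
    (hd : ∀ᵐ t, T₀ ≤ t → ∃ v, HasDerivAt V v t ∧ v ≤ -(c * (α t * ψ t)) + B * α t ^ 2) :
    (∃ L, Tendsto V atTop (𝓝 L)) ∧ ∀ ε > 0, ∃ᶠ t in atTop, ψ t < ε := by
  have hAC : ∀ a b, 0 ≤ a → a ≤ b → AbsolutelyContinuousOnInterval V a b := fun a b ha hab =>
    (hV b (ha.trans hab)).mono (by
      rw [uIcc_of_le hab, uIcc_of_le (ha.trans hab)]; exact Icc_subset_Icc_left ha)
  have hαi : ∀ a b, 0 ≤ a → a ≤ b → IntervalIntegrable α volume a b := fun a b ha hab =>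
    (hαcont.mono (by rw [uIcc_of_le hab]; exact fun t ht => ha.trans ht.1)).intervalIntegrable
  have hα2i : ∀ a b, 0 ≤ a → a ≤ b → IntervalIntegrable (fun t => α t ^ 2) volume a b :=
    fun a b ha hab => ((hαcont.mono (by
      rw [uIcc_of_le hab]; exact fun t ht => ha.trans ht.1)).pow 2).intervalIntegrable
  have hlim2 : Tendsto (fun T => ∫ t in T₀..T, α t ^ 2) atTop
      (𝓝 (∫ t in Ioi T₀, α t ^ 2)) :=
    intervalIntegral_tendsto_integral_Ioi _
      (hαsq.mono_set (fun t ht => hT₀.trans (le_of_lt ht))) tendsto_id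
  have hle2 : ∀ T, T₀ ≤ T → ∫ t in T₀..T, α t ^ 2 ≤ ∫ t in Ioi T₀, α t ^ 2 := by
    intro T hT
    rw [intervalIntegral.integral_of_le hT]
    exact setIntegral_mono_set (hαsq.mono_set (fun t ht => hT₀.trans (le_of_lt ht)))
      (Eventually.of_forall fun t => sq_nonneg _) (Ioc_subset_Ioi_self).eventuallyLE
  set M := ∫ t in Ioi T₀, α t ^ 2
  constructor
  -- Subtracting the accumulated perturbation makes the energy monotone; `max T T₀` freezes it
  -- before `T₀`, so that it is antitone on all of `ℝ`.
  · set U : ℝ → ℝ := fun T => V (max T T₀) - B * ∫ t in T₀..(max T T₀), α t ^ 2 with hU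
    have hanti : Antitone U := by
      intro s t hst
      have h1 : max s T₀ ≤ max t T₀ := max_le_max_right _ hst
      have h0 : T₀ ≤ max s T₀ := le_max_right _ _
      have h2 := (hAC _ _ (hT₀.trans h0) h1).sub_le_integral_of_deriv_le h1
        ((hα2i _ _ (hT₀.trans h0) h1).const_mul B) (by
          filter_upwards [hd] with τ hτ hm
          obtain ⟨v, hv, hvk⟩ := hτ (h0.trans hm.1)
          refine ⟨v, hv, hvk.trans ?_⟩
          have := mul_nonneg hc.le (mul_nonneg
            (hαpos τ (hT₀.trans (h0.trans hm.1))).le (hψ0 τ))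
          linarith)
      rw [intervalIntegral.integral_const_mul] at h2
      have h3 := intervalIntegral.integral_add_adjacent_intervals (hα2i _ _ hT₀ h0)
        (hα2i _ _ (hT₀.trans h0) h1)
      simp only [hU]
      rw [← h3]
      linarith
    have hbdd : BddBelow (range U) := by
      refine ⟨-(B * M), ?_⟩
      rintro _ ⟨t, rfl⟩
      have := mul_le_mul_of_nonneg_left (hle2 _ (le_max_right t T₀)) hB
      have := hV0 (max t T₀)
      simp only [hU]
      linarith
    refine ⟨_, ((tendsto_atTop_ciInf hanti hbdd).add (hlim2.const_mul B)).congr' ?_⟩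
    filter_upwards [eventually_ge_atTop T₀] with t ht
    simp [hU, max_eq_left ht]
  · intro ε hε hnot
    have hev : ∀ᶠ t in atTop, ε ≤ ψ t := by
      filter_upwards [hnot] with t ht using not_lt.1 ht
    obtain ⟨T₁, hT₁⟩ := eventually_atTop.1 hev
    set T₂ := max T₀ T₁
    have hT₂ : 0 ≤ T₂ := hT₀.trans (le_max_left _ _)
    -- If `ψ ≥ ε` after `T₂`, the energy loses `c ε ∫ α` and regains at most a bounded amount; this
    -- `T` is late enough to force `V T < 0`.
    obtain ⟨T, hTbig, hTT⟩ := ((hαint.eventually_gt_atTop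
      ((∫ t in (0 : ℝ)..T₂, α t) + (V T₂ + B * M + B * |∫ t in T₀..T₂, α t ^ 2|) / (c * ε))).and
      (eventually_ge_atTop T₂)).exists
    have h2 := (hAC _ _ hT₂ hTT).sub_le_integral_of_deriv_le
      (k := fun t => -(c * ε) * α t + B * α t ^ 2) hTT
      (((hαi _ _ hT₂ hTT).const_mul _).add ((hα2i _ _ hT₂ hTT).const_mul B)) (by
        filter_upwards [hd] with τ hτ hm
        obtain ⟨v, hv, hvk⟩ := hτ ((le_max_left _ _).trans hm.1)
        refine ⟨v, hv, hvk.trans ?_⟩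
        have h3 := mul_le_mul_of_nonneg_left (hT₁ τ ((le_max_right _ _).trans hm.1))
          (mul_nonneg hc.le (hαpos τ (hT₂.trans hm.1)).le)
        nlinarith)
    rw [intervalIntegral.integral_add ((hαi _ _ hT₂ hTT).const_mul _)
      ((hα2i _ _ hT₂ hTT).const_mul B), intervalIntegral.integral_const_mul,
      intervalIntegral.integral_const_mul] at h2
    have h3 := intervalIntegral.integral_add_adjacent_intervals (hαi 0 T₂ le_rfl hT₂)
      (hαi _ _ hT₂ hTT)
    have h4 := intervalIntegral.integral_add_adjacent_intervals
      (hα2i _ _ hT₀ (le_max_left T₀ T₁)) (hα2i _ _ hT₂ hTT)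
    have h5 := mul_le_mul_of_nonneg_left (hle2 _ ((le_max_left T₀ T₁).trans hTT)) hB
    rw [← h4, mul_add] at h5
    have h6 : (V T₂ + B * M + B * |∫ t in T₀..T₂, α t ^ 2|) / (c * ε) < ∫ t in T₂..T, α t := by
      linarith
    rw [div_lt_iff₀ (mul_pos hc hε)] at h6
    have h7 := mul_le_mul_of_nonneg_left (neg_abs_le (∫ t in T₀..T₂, α t ^ 2)) hB
    have h8 := hV0 T
    nlinarith

/-! ### Weighted graphs and their Laplacians -/

theorem SimpleGraph.Walk.norm_sub_le {ι E : Type*} [SeminormedAddCommGroup E]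
    {g : SimpleGraph ι} (x : ι → E) {M : ℝ} (hM : ∀ i j, g.Adj i j → ‖x i - x j‖ ≤ M) {u v : ι}
    (p : g.Walk u v) : ‖x u - x v‖ ≤ p.length * M := by
  induction p with
  | nil => simp
  | @cons a b c h p ih =>
    calc ‖x a - x c‖ = ‖(x a - x b) + (x b - x c)‖ := by congr 1; abel
      _ ≤ ‖x a - x b‖ + ‖x b - x c‖ := norm_add_le _ _
      _ ≤ M + p.length * M := add_le_add (hM _ _ h) ih
      _ = _ := by simp; ring

namespace NetworkLS

variable {N m : ℕ}

theorem adjacency_nonneg {w : Sym2 (Fin N) → ℝ} {g : SimpleGraph (Fin N)}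
    (hw : ∀ e ∈ g.edgeSet, 0 < w e) (i j : Fin N) : 0 ≤ adjacency w g i j := by
  simp only [adjacency, Matrix.of_apply]
  split_ifs with h
  · exact (hw _ h).le
  · exact le_rfl

theorem adjacency_comm (w : Sym2 (Fin N) → ℝ) (g : SimpleGraph (Fin N)) (i j : Fin N) :
    adjacency w g i j = adjacency w g j i := by
  simp only [adjacency, Matrix.of_apply, Sym2.eq_swap (a := i)]
  by_cases h : g.Adj i j <;> simp [h, g.adj_comm j i]

open Classical in
theorem sum_neighborFinset_adjacency {E : Type*} [AddCommGroup E] [Module ℝ E]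
    (w : Sym2 (Fin N) → ℝ) (g : SimpleGraph (Fin N)) (i : Fin N) (f : Fin N → E) :
    ∑ j ∈ g.neighborFinset i, adjacency w g i j • f j = ∑ j, adjacency w g i j • f j := by
  refine Finset.sum_subset (Finset.subset_univ _) fun j _ hj => ?_
  have : ¬ g.Adj i j := by simpa using hj
  simp [adjacency, this]

/-- Poincaré inequality on a connected weighted graph. -/
theorem exists_spectral_gap {E : Type*} [SeminormedAddCommGroup E] {w : Sym2 (Fin N) → ℝ}
    {g : SimpleGraph (Fin N)} (hg : g.Connected) (hw : ∀ e ∈ g.edgeSet, 0 < w e) (k : Fin N) :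
    ∃ c > 0, ∀ x : Fin N → E,
      c * ∑ i, ‖x i - x k‖ ^ 2 ≤ ∑ i, ∑ j, adjacency w g i j * ‖x i - x j‖ ^ 2 := by
  obtain ⟨δ, hδ, hδw⟩ : ∃ δ > 0, ∀ e ∈ g.edgeSet, δ ≤ w e := by
    rcases g.edgeSet.eq_empty_or_nonempty with h | h
    · exact ⟨1, one_pos, by simp [h]⟩
    · obtain ⟨e, he, hmin⟩ := g.edgeSet.toFinite.exists_minimalFor w _ h
      exact ⟨w e, hw e he, fun e' he' => (le_total (w e) (w e')).elim id (hmin he')⟩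
  have p : ∀ i, g.Walk i k := fun i => (hg.preconnected i k).some
  -- The `+ 1` keeps `L` positive when every chosen walk is trivial.
  set L : ℝ := ∑ i, (p i).length ^ 2 + 1 with hL
  have hLpos : 0 < L := by positivity
  refine ⟨δ / L, div_pos hδ hLpos, fun x => ?_⟩
  set D := ∑ i, ∑ j, adjacency w g i j * ‖x i - x j‖ ^ 2 with hD
  have hterm : ∀ i j, 0 ≤ adjacency w g i j * ‖x i - x j‖ ^ 2 := fun i j =>
    mul_nonneg (adjacency_nonneg hw i j) (sq_nonneg _)
  have hD0 : 0 ≤ D := Finset.sum_nonneg fun i _ => Finset.sum_nonneg fun j _ => hterm i j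
  have hM : ∀ i j, g.Adj i j → ‖x i - x j‖ ≤ Real.sqrt (D / δ) := by
    intro i j hij
    refine Real.le_sqrt_of_sq_le ?_
    rw [le_div_iff₀ hδ]
    calc ‖x i - x j‖ ^ 2 * δ ≤ adjacency w g i j * ‖x i - x j‖ ^ 2 := by
          rw [mul_comm]
          gcongr
          simpa [adjacency, hij] using hδw _ (g.mem_edgeSet.2 hij)
      _ ≤ ∑ j, adjacency w g i j * ‖x i - x j‖ ^ 2 :=
          Finset.single_le_sum (f := fun j => adjacency w g i j * ‖x i - x j‖ ^ 2)
            (fun j _ => hterm i j) (Finset.mem_univ j)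
      _ ≤ D := Finset.single_le_sum
            (f := fun i => ∑ j, adjacency w g i j * ‖x i - x j‖ ^ 2)
            (fun i _ => Finset.sum_nonneg fun j _ => hterm i j) (Finset.mem_univ i)
  have hsum : ∑ i, ‖x i - x k‖ ^ 2 ≤ L * (D / δ) := by
    calc ∑ i, ‖x i - x k‖ ^ 2 ≤ ∑ i, ((p i).length : ℝ) ^ 2 * (D / δ) := by
          refine Finset.sum_le_sum fun i _ => ?_
          calc ‖x i - x k‖ ^ 2 ≤ ((p i).length * Real.sqrt (D / δ)) ^ 2 := by
                gcongr; exact (p i).norm_sub_le x hM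
            _ = _ := by rw [mul_pow, Real.sq_sqrt (div_nonneg hD0 hδ.le)]
      _ ≤ L * (D / δ) := by
          rw [← Finset.sum_mul]
          gcongr
          simp [hL]
  calc δ / L * ∑ i, ‖x i - x k‖ ^ 2 ≤ δ / L * (L * (D / δ)) := by gcongr
    _ = D := by field_simp

theorem exists_uniform_spectral_gap {E : Type*} [SeminormedAddCommGroup E]
    {Q : Set (SimpleGraph (Fin N))} {w : Sym2 (Fin N) → ℝ} (hQ : ∀ g ∈ Q, g.Connected)
    (hw : ∀ g ∈ Q, ∀ e ∈ g.edgeSet, 0 < w e) (k : Fin N) :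
    ∃ c > 0, ∀ g ∈ Q, ∀ x : Fin N → E,
      c * ∑ i, ‖x i - x k‖ ^ 2 ≤ ∑ i, ∑ j, adjacency w g i j * ‖x i - x j‖ ^ 2 := by
  rcases Q.eq_empty_or_nonempty with rfl | hne
  · exact ⟨1, one_pos, by simp⟩
  choose! c hc hgap using fun g (hg : g ∈ Q) =>
    exists_spectral_gap (E := E) (hQ g hg) (hw g hg) k
  -- There are only finitely many graphs on `Fin N`, so a smallest gap exists.
  obtain ⟨g₀, hg₀, hmin⟩ := Q.toFinite.exists_minimalFor c _ hne
  refine ⟨c g₀, hc g₀ hg₀, fun g hg x => le_trans ?_ (hgap g hg x)⟩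
  gcongr
  exact (le_total (c g₀) (c g)).elim id (hmin hg)

/-- By symmetry of `A`, the double sum may be averaged with its copy under `i ↔ j`; the base point
`y` then cancels. -/
theorem sum_inner_laplacian {E : Type*} [NormedAddCommGroup E] [InnerProductSpace ℝ E]
    {A : Fin N → Fin N → ℝ} (hA : ∀ i j, A i j = A j i) (x : Fin N → E) (y : E) :
    2 * ∑ i, inner ℝ (x i - y) (∑ j, A i j • (x j - x i)) =
      -∑ i, ∑ j, A i j * ‖x i - x j‖ ^ 2 := by
  have h1 : ∑ i, inner ℝ (x i - y) (∑ j, A i j • (x j - x i)) =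
      ∑ i, ∑ j, A i j * inner ℝ (x i - y) (x j - x i) := by
    simp_rw [inner_sum, inner_smul_right]
  have h2 : ∑ i, ∑ j, A i j * inner ℝ (x i - y) (x j - x i) =
      ∑ i, ∑ j, A i j * inner ℝ (x j - y) (x i - x j) := by
    rw [Finset.sum_comm]
    simp_rw [fun i j => hA j i]
  rw [h1, two_mul]
  nth_rewrite 2 [h2]
  simp_rw [← Finset.sum_add_distrib, ← Finset.sum_neg_distrib]
  refine Finset.sum_congr rfl fun i _ => Finset.sum_congr rfl fun j _ => ?_
  have h3 : inner ℝ (x j - y) (x i - x j) = -inner ℝ (x j - y) (x j - x i) := by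
    rw [← inner_neg_right, neg_sub]
  have h4 : ‖x i - x j‖ ^ 2 = inner ℝ ((x j - y) - (x i - y)) (x j - x i) := by
    rw [sub_sub_sub_cancel_right, real_inner_self_eq_norm_sq, norm_sub_rev]
  rw [h3, h4, inner_sub_left (x j - y)]
  ring

/-! ### Least squares and the normal equations -/

theorem gradient_localCost (H : Matrix (Fin N) (Fin m) ℝ) (z : EuclideanSpace ℝ (Fin N))
    (i : Fin N) (y : EuclideanSpace ℝ (Fin m)) :
    gradient (localCost H z i) y = (2 * (inner ℝ (row H i) y - z i)) • row H i := by
  refine HasGradientAt.gradient ?_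
  rw [hasGradientAt_iff_hasFDerivAt]
  have h := ((innerSL ℝ (row H i)).hasFDerivAt (x := y)).sub_const (z i) |>.pow 2
  have e : localCost H z i = fun y => (innerSL ℝ (row H i) y - z i) ^ 2 := by
    funext y; simp [localCost]
  rw [e]
  refine h.congr_fderiv ?_
  ext v
  simp

/-- The normal equations `Hᵀ (H y - z) = 0`. -/
def NormalEquations (H : Matrix (Fin N) (Fin m) ℝ) (z : EuclideanSpace ℝ (Fin N))
    (y : EuclideanSpace ℝ (Fin m)) : Prop :=
  ∀ d, ∑ i, (inner ℝ (row H i) y - z i) * inner ℝ (row H i) d = 0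

theorem inner_row (H : Matrix (Fin N) (Fin m) ℝ) (i : Fin N) (y : EuclideanSpace ℝ (Fin m)) :
    inner ℝ (row H i) y = H.mulVec y.ofLp i := by
  simp [row, PiLp.inner_apply, Matrix.mulVec, dotProduct, mul_comm]

theorem cost_eq_sum (H : Matrix (Fin N) (Fin m) ℝ) (z : EuclideanSpace ℝ (Fin N))
    (y : EuclideanSpace ℝ (Fin m)) :
    cost H z y = ∑ i, (inner ℝ (row H i) y - z i) ^ 2 := by
  simp only [cost, EuclideanSpace.norm_sq_eq, inner_row]
  refine Finset.sum_congr rfl fun i _ => ?_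
  simp only [PiLp.sub_apply, Real.norm_eq_abs, sq_abs]
  ring

/-- The orthogonal projection of `z` onto the range of `H` has the form `H y`, and its residual is
orthogonal to every `H d`; no rank condition is needed. -/
theorem exists_normalEquations (H : Matrix (Fin N) (Fin m) ℝ) (z : EuclideanSpace ℝ (Fin N)) :
    ∃ y, NormalEquations H z y := by
  set T := Matrix.toEuclideanLin H
  obtain ⟨y, hy⟩ := LinearMap.mem_range.1
    ((LinearMap.range T).starProjection_apply_mem z)
  refine ⟨y, fun d => ?_⟩
  have h := (LinearMap.range T).starProjection_inner_eq_zero z (T d)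
    (LinearMap.mem_range_self T d)
  rw [← hy, ← neg_eq_zero, ← inner_neg_left, neg_sub] at h
  rw [← h]
  simp only [inner_row]
  simp [PiLp.inner_apply, T, Matrix.toLpLin_apply, mul_comm]

namespace NormalEquations

variable {H : Matrix (Fin N) (Fin m) ℝ} {z : EuclideanSpace ℝ (Fin N)}
  {y : EuclideanSpace ℝ (Fin m)}

theorem cost_eq (hy : NormalEquations H z y) (y' : EuclideanSpace ℝ (Fin m)) :
    cost H z y' = cost H z y + ∑ i, inner ℝ (row H i) (y' - y) ^ 2 := by
  have h := hy (y' - y)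
  have h2 : cost H z y' = cost H z y + ∑ i, inner ℝ (row H i) (y' - y) ^ 2 +
      2 * ∑ i, (inner ℝ (row H i) y - z i) * inner ℝ (row H i) (y' - y) := by
    rw [cost_eq_sum, cost_eq_sum, Finset.mul_sum, ← Finset.sum_add_distrib,
      ← Finset.sum_add_distrib]
    refine Finset.sum_congr rfl fun i _ => ?_
    rw [inner_sub_right]
    ring
  rw [h2, h]
  ring

theorem mem_leastSquaresSolutions (hy : NormalEquations H z y) :
    y ∈ leastSquaresSolutions H z := by
  intro y' _
  change cost H z y ≤ cost H z y'
  rw [hy.cost_eq y']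
  exact le_add_of_nonneg_right (Finset.sum_nonneg fun i _ => sq_nonneg _)

theorem of_inner_row_sub_eq_zero (hy : NormalEquations H z y) {y' : EuclideanSpace ℝ (Fin m)}
    (h : ∀ i, inner ℝ (row H i) (y' - y) = 0) : NormalEquations H z y' := by
  intro d
  rw [← hy d]
  refine Finset.sum_congr rfl fun i _ => ?_
  have := h i
  rw [inner_sub_right, sub_eq_zero] at this
  rw [this]

theorem eq_of_rank_eq (hy : NormalEquations H z y) (hH : H.rank = m)
    {y' : EuclideanSpace ℝ (Fin m)} (hy' : y' ∈ leastSquaresSolutions H z) : y' = y := by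
  have h1 : cost H z y' ≤ cost H z y := hy' (mem_univ y)
  rw [hy.cost_eq y'] at h1
  have h2 : ∑ i, inner ℝ (row H i) (y' - y) ^ 2 = 0 :=
    le_antisymm (by linarith) (Finset.sum_nonneg fun i _ => sq_nonneg _)
  rw [Finset.sum_eq_zero_iff_of_nonneg fun i _ => sq_nonneg _] at h2
  have h3 : H.mulVecLin (y' - y).ofLp = 0 := by
    funext i
    have := pow_eq_zero_iff (two_ne_zero) |>.1 (h2 i (Finset.mem_univ i))
    rwa [inner_row] at this
  have hker : LinearMap.ker H.mulVecLin = ⊥ := by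
    have h4 := LinearMap.finrank_range_add_finrank_ker H.mulVecLin
    have h5 : Module.finrank ℝ (LinearMap.range H.mulVecLin) = m := hH
    rw [h5, Module.finrank_fin_fun] at h4
    exact Submodule.finrank_eq_zero.1 (by omega)
  have h6 := LinearMap.ker_eq_bot'.1 hker _ h3
  rw [← sub_eq_zero]
  ext i
  exact congrFun h6 i

/-- The derivative of `∑ ‖xᵢ - y‖²` along the flow is bounded by minus the disagreement, minus the
step size times the excess cost, up to a term quadratic in the step size. -/
theorem sum_inner_flowField_le (hy : NormalEquations H z y) {w : Sym2 (Fin N) → ℝ}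
    {K c a : ℝ} (hK : 0 < K) (hc : 0 < c) {g : SimpleGraph (Fin N)} (k : Fin N)
    (x : Fin N → EuclideanSpace ℝ (Fin m))
    (hgap : c * ∑ i, ‖x i - x k‖ ^ 2 ≤ ∑ i, ∑ j, adjacency w g i j * ‖x i - x j‖ ^ 2) :
    ∑ i, 2 * inner ℝ (x i - y) (flowField H z w K g a x i) ≤
      -(K * c / 2 * ∑ i, ‖x i - x k‖ ^ 2) - 2 * a * ∑ i, inner ℝ (row H i) (x i - y) ^ 2 +
      (∑ i, (inner ℝ (row H i) y - z i) ^ 2 * ‖row H i‖ ^ 2 / (K * c / 2)) * a ^ 2 := by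
  set η := K * c / 2 with hη
  have hηpos : 0 < η := by positivity
  set r : Fin N → ℝ := fun i => inner ℝ (row H i) y - z i with hr
  have h1 : ∑ i, 2 * inner ℝ (x i - y) (flowField H z w K g a x i) =
      -(K * ∑ i, ∑ j, adjacency w g i j * ‖x i - x j‖ ^ 2) -
        2 * a * ∑ i, inner ℝ (row H i) (x i - y) ^ 2 -
        2 * a * ∑ i, r i * inner ℝ (row H i) (x i - y) := by
    have hlap := sum_inner_laplacian (adjacency_comm w g) x y
    rw [← mul_neg, ← hlap, Finset.mul_sum, Finset.mul_sum, Finset.mul_sum, Finset.mul_sum,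
      ← Finset.sum_sub_distrib, ← Finset.sum_sub_distrib]
    refine Finset.sum_congr rfl fun i _ => ?_
    simp only [flowField]
    rw [sum_neighborFinset_adjacency, gradient_localCost, inner_sub_right, inner_smul_right,
      inner_smul_right, inner_smul_right, real_inner_comm (row H i) (x i - y)]
    simp only [hr]
    rw [show inner ℝ (row H i) (x i) = inner ℝ (row H i) (x i - y) + inner ℝ (row H i) y by
      rw [← inner_add_right, sub_add_cancel]]
    ring
  -- Since `∑ rᵢ hᵢ = 0`, the common shift from `y` to `xₖ` is free, which leaves only the
  -- disagreement.
  have h2 : ∑ i, r i * inner ℝ (row H i) (x i - y) =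
      ∑ i, r i * inner ℝ (row H i) (x i - x k) := by
    have h := hy (x k - y)
    rw [← sub_eq_zero, ← h, ← Finset.sum_sub_distrib]
    refine Finset.sum_congr rfl fun i _ => ?_
    rw [show x i - y = (x i - x k) + (x k - y) by abel, inner_add_right]
    ring
  -- Young's inequality `2ud ≤ η d² + u² / η`, where `η` is half of the rate `K c` supplied by the
  -- gap.
  have h3 : -(2 * a * ∑ i, r i * inner ℝ (row H i) (x i - x k)) ≤
      η * ∑ i, ‖x i - x k‖ ^ 2 + (∑ i, r i ^ 2 * ‖row H i‖ ^ 2 / η) * a ^ 2 := by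
    rw [Finset.mul_sum, Finset.mul_sum, Finset.sum_mul, ← Finset.sum_add_distrib,
      ← Finset.sum_neg_distrib]
    refine Finset.sum_le_sum fun i _ => ?_
    set p := inner ℝ (row H i) (x i - x k)
    have hp : p ^ 2 ≤ ‖row H i‖ ^ 2 * ‖x i - x k‖ ^ 2 := by
      rw [← mul_pow]
      exact sq_le_sq' (by linarith [neg_le_of_abs_le (abs_real_inner_le_norm (row H i) (x i - x k))])
        (real_inner_le_norm _ _)
    have e : r i ^ 2 * ‖row H i‖ ^ 2 / η * a ^ 2 = (a * r i * ‖row H i‖) ^ 2 / η := by ring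
    rw [e]
    have hq : -(2 * a * (r i * p)) ≤ 2 * (|a * r i| * ‖row H i‖ * ‖x i - x k‖) := by
      have := (neg_le_abs (a * r i * p))
      rw [abs_mul] at this
      have h' := mul_le_mul_of_nonneg_left (abs_real_inner_le_norm (row H i) (x i - x k))
        (abs_nonneg (a * r i))
      linarith
    refine hq.trans ?_
    have hs : (a * r i * ‖row H i‖) ^ 2 = (|a * r i| * ‖row H i‖) ^ 2 := by
      rw [mul_pow, mul_pow _ ‖row H i‖, sq_abs]
    rw [hs]
    set u := |a * r i| * ‖row H i‖
    set d := ‖x i - x k‖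
    have : η * d ^ 2 + u ^ 2 / η - 2 * (u * d) = (η * d - u) ^ 2 / η := by field_simp; ring
    have : 0 ≤ (η * d - u) ^ 2 / η := by positivity
    linarith
  rw [h1, h2]
  have h4 := mul_le_mul_of_nonneg_left hgap hK.le
  have h5 : K * (c * ∑ i, ‖x i - x k‖ ^ 2) = 2 * (η * ∑ i, ‖x i - x k‖ ^ 2) := by
    rw [hη]; ring
  linarith

end NormalEquations

/-! ### The energy along a solution -/

theorem absolutelyContinuousOnInterval_norm_sub_sq {E : Type*} [NormedAddCommGroup E]
    {f : ℝ → E} {a b : ℝ} (hf : AbsolutelyContinuousOnInterval f a b) (y : E) :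
    AbsolutelyContinuousOnInterval (fun t => ‖f t - y‖ ^ 2) a b := by
  have h : AbsolutelyContinuousOnInterval (fun t => ‖f t - y‖) a b := by
    refine squeeze_zero (fun _ => Finset.sum_nonneg fun _ _ => dist_nonneg) (fun E => ?_) hf
    refine Finset.sum_le_sum fun i _ => ?_
    simp only [dist_eq_norm, Real.norm_eq_abs]
    refine (abs_norm_sub_norm_le _ _).trans_eq ?_
    rw [sub_sub_sub_cancel_right]
  simpa only [sq] using! h.fun_mul h

theorem absolutelyContinuousOnInterval_sum {ι : Type*} (s : Finset ι) {f : ι → ℝ → ℝ} {a b : ℝ}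
    (hf : ∀ i ∈ s, AbsolutelyContinuousOnInterval (f i) a b) :
    AbsolutelyContinuousOnInterval (fun t => ∑ i ∈ s, f i t) a b := by
  classical
  induction s using Finset.induction_on with
  | empty =>
    simpa using (LipschitzWith.const (0 : ℝ)).lipschitzOnWith.absolutelyContinuousOnInterval
  | insert i s hi ih =>
    simp_rw [Finset.sum_insert hi]
    exact (hf i (Finset.mem_insert_self i s)).fun_add
      (ih fun j hj => hf j (Finset.mem_insert_of_mem hj))

/-- Along a solution the squared distance to a solution of the normal equations converges, and
disagreement and excess cost are simultaneously small at arbitrarily late times. -/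
theorem IsFlowSolution.energy {H : Matrix (Fin N) (Fin m) ℝ} {z : EuclideanSpace ℝ (Fin N)}
    {Q : Set (SimpleGraph (Fin N))} (hQ : ∀ g ∈ Q, g.Connected)
    {w : Sym2 (Fin N) → ℝ} (hw : ∀ g ∈ Q, ∀ e ∈ g.edgeSet, 0 < w e)
    {G : ℝ → SimpleGraph (Fin N)} (hG : ∀ t, 0 ≤ t → G t ∈ Q) {K : ℝ} (hK : 0 < K)
    {α : ℝ → ℝ} (hαcont : ContinuousOn α (Ici 0)) (hαpos : ∀ t, 0 ≤ t → 0 < α t)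
    (hαint : Tendsto (fun T : ℝ => ∫ t in (0 : ℝ)..T, α t) atTop atTop)
    (hαlim : Tendsto α atTop (𝓝 0)) (hαsq : IntegrableOn (fun t => α t ^ 2) (Ici 0))
    {x : Fin N → ℝ → EuclideanSpace ℝ (Fin m)} (hx : IsFlowSolution H z w K G α x)
    {y : EuclideanSpace ℝ (Fin m)} (hy : NormalEquations H z y) (k : Fin N) :
    (∃ L, Tendsto (fun t => ∑ i, ‖x i t - y‖ ^ 2) atTop (𝓝 L)) ∧
    ∀ ε > 0, ∃ᶠ t in atTop,
      ∑ i, ‖x i t - x k t‖ ^ 2 + ∑ i, inner ℝ (row H i) (x i t - y) ^ 2 < ε := by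
  obtain ⟨c, hc, hgap⟩ :=
    exists_uniform_spectral_gap (E := EuclideanSpace ℝ (Fin m)) hQ hw k
  obtain ⟨T₀, hT₀⟩ := eventually_atTop.1 (hαlim.eventually_le_const one_pos)
  have hη : 0 < K * c / 2 := by positivity
  refine dissipation (T₀ := max T₀ 0) (c := min (K * c / 2) 2)
    (B := ∑ i, (inner ℝ (row H i) y - z i) ^ 2 * ‖row H i‖ ^ 2 / (K * c / 2))
    (lt_min hη two_pos) (Finset.sum_nonneg fun i _ => by positivity) (le_max_right _ _) hαcont
    hαpos hαint hαsq (fun t => Finset.sum_nonneg fun i _ => sq_nonneg _)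
    (fun t => by positivity)
    (fun T hT => absolutelyContinuousOnInterval_sum _ fun i _ =>
      absolutelyContinuousOnInterval_norm_sub_sq (hx.absolutelyContinuous i T hT) y) ?_
  have hder := ae_all_iff.2 hx.hasDerivAt
  rw [ae_restrict_iff' measurableSet_Ici] at hder
  filter_upwards [hder] with t ht htT
  have ht0 : 0 ≤ t := (le_max_right _ _).trans htT
  have hα1 : α t ≤ 1 := hT₀ t ((le_max_left _ _).trans htT)
  have hα0 := (hαpos t ht0).le
  refine ⟨_, HasDerivAt.fun_sum fun i _ => ((ht ht0 i).sub_const y).norm_sq, ?_⟩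
  refine (hy.sum_inner_flowField_le hK hc k _ (hgap _ (hG t ht0) _)).trans ?_
  set S := ∑ i, ‖x i t - x k t‖ ^ 2
  set φ := ∑ i, inner ℝ (row H i) (x i t - y) ^ 2
  have hS : 0 ≤ S := Finset.sum_nonneg fun i _ => sq_nonneg _
  have hφ : 0 ≤ φ := Finset.sum_nonneg fun i _ => sq_nonneg _
  -- Once `α ≤ 1`, the disagreement rate may be weakened by a factor `α`, so that both dissipation
  -- terms have the form required by `dissipation`.
  have h1 : min (K * c / 2) 2 * (α t * S) ≤ K * c / 2 * S :=
    mul_le_mul (min_le_left _ _) (mul_le_of_le_one_left hS hα1) (mul_nonneg hα0 hS) hη.le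
  have h2 : min (K * c / 2) 2 * (α t * φ) ≤ 2 * (α t * φ) :=
    mul_le_mul_of_nonneg_right (min_le_right _ _) (mul_nonneg hα0 hφ)
  linarith [mul_add (min (K * c / 2) 2) (α t * S) (α t * φ), mul_add (α t) S φ,
    congrArg (min (K * c / 2) 2 * ·) (mul_add (α t) S φ)]

end NetworkLS

/-! ### Convergence to a least-squares solution -/

theorem theorem3 {N m : ℕ} (hmN : m ≤ N)
    (H : Matrix (Fin N) (Fin m) ℝ) (z : EuclideanSpace ℝ (Fin N))
    (Q : Set (SimpleGraph (Fin N))) (hQ : ∀ g ∈ Q, g.Connected)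
    (w : Sym2 (Fin N) → ℝ) (hw : ∀ g ∈ Q, ∀ e ∈ g.edgeSet, 0 < w e)
    (G : ℝ → SimpleGraph (Fin N)) (hG : ∀ t, 0 ≤ t → G t ∈ Q)
    (hGpc : NetworkLS.PiecewiseConstant G)
    (K : ℝ) (hK : 0 < K)
    (α : ℝ → ℝ) (hαcont : ContinuousOn α (Ici 0)) (hαpos : ∀ t, 0 ≤ t → 0 < α t)
    (hαint : Tendsto (fun T : ℝ => ∫ t in (0 : ℝ)..T, α t) atTop atTop)
    (hαlim : Tendsto α atTop (𝓝 0))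
    (hαsq : IntegrableOn (fun t => α t ^ 2) (Ici 0)) :
    (H.rank = m → (NetworkLS.leastSquaresSolutions H z).encard = 1) ∧
    ∀ x : Fin N → ℝ → EuclideanSpace ℝ (Fin m),
      NetworkLS.IsFlowSolution H z w K G α x →
      ∃ y ∈ NetworkLS.leastSquaresSolutions H z,
        ∀ i, Tendsto (x i) atTop (𝓝 y) := by
  obtain ⟨y₀, hy₀⟩ := NetworkLS.exists_normalEquations H z
  refine ⟨fun hH => encard_eq_one.2 ⟨y₀, eq_singleton_iff_unique_mem.2
    ⟨hy₀.mem_leastSquaresSolutions, fun y hy => hy₀.eq_of_rank_eq hH hy⟩⟩, fun x hx => ?_⟩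
  obtain ⟨k⟩ := (hQ _ (hG 0 le_rfl)).nonempty
  have henergy := fun y hy => hx.energy (y := y) hQ hw hG hK hαcont hαpos hαint hαlim hαsq hy k
  obtain ⟨⟨L, hL⟩, hfreq⟩ := henergy y₀ hy₀
  set X : ℝ → Fin N → EuclideanSpace ℝ (Fin m) := fun t i => x i t with hX
  set F : (Fin N → EuclideanSpace ℝ (Fin m)) → ℝ := fun v =>
    ∑ i, ‖v i - v k‖ ^ 2 + ∑ i, inner ℝ (NetworkLS.row H i) (v i - y₀) ^ 2 with hF
  have hFcont : Continuous F := by fun_prop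
  obtain ⟨T₁, hT₁⟩ := eventually_atTop.1 (hL.eventually_le_const (lt_add_one L))
  have hbound : ∀ t, T₁ ≤ t → X t ∈ Metric.closedBall (fun _ => y₀) (Real.sqrt (L + 1)) := by
    intro t ht
    rw [mem_closedBall_iff_norm, pi_norm_le_iff_of_nonneg (Real.sqrt_nonneg _)]
    intro i
    refine Real.le_sqrt_of_sq_le (le_trans ?_ (hT₁ t ht))
    exact Finset.single_le_sum (f := fun i => ‖x i t - y₀‖ ^ 2) (fun i _ => sq_nonneg _)
      (Finset.mem_univ i)
  choose s hsT hs using fun n : ℕ => frequently_atTop.1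
    (hfreq (1 / ((n : ℝ) + 1)) Nat.one_div_pos_of_nat) (max T₁ n)
  obtain ⟨v, -, θ, hθ, hv⟩ := tendsto_subseq_of_bounded Metric.isBounded_closedBall
    (fun n => hbound (s n) ((le_max_left _ _).trans (hsT n)))
  have hs_top : Tendsto (s ∘ θ) atTop atTop :=
    (tendsto_atTop_mono (fun n => (le_max_right _ _).trans (hsT n))
      tendsto_natCast_atTop_atTop).comp hθ.tendsto_atTop
  have hF0 : F v ≤ 0 := le_of_tendsto_of_tendsto' ((hFcont.tendsto v).comp hv)
    (tendsto_one_div_add_atTop_nhds_zero_nat.comp hθ.tendsto_atTop) fun n => (hs (θ n)).le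
  have h1 : 0 ≤ ∑ i, ‖v i - v k‖ ^ 2 := Finset.sum_nonneg fun i _ => sq_nonneg _
  have h2 : 0 ≤ ∑ i, inner ℝ (NetworkLS.row H i) (v i - y₀) ^ 2 :=
    Finset.sum_nonneg fun i _ => sq_nonneg _
  have h3 := (Finset.sum_eq_zero_iff_of_nonneg fun i _ => sq_nonneg _).1
    (le_antisymm (by linarith) h1)
  have h4 := (Finset.sum_eq_zero_iff_of_nonneg fun i _ => sq_nonneg _).1
    (le_antisymm (by linarith) h2)
  have hcons : ∀ i, v i = v k := fun i => by simpa [sub_eq_zero] using h3 i (Finset.mem_univ i)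
  have hnormal : NetworkLS.NormalEquations H z (v k) := hy₀.of_inner_row_sub_eq_zero fun i => by
    simpa [hcons i] using h4 i (Finset.mem_univ i)
  refine ⟨v k, hnormal.mem_leastSquaresSolutions, fun i => ?_⟩
  obtain ⟨L', hL'⟩ := (henergy (v k) hnormal).1
  -- The limit of the energy based at `v k` can be read off along `s ∘ θ`, where every component
  -- tends to `v k`.
  have hL'0 : L' = 0 := by
    refine tendsto_nhds_unique (hL'.comp hs_top) ?_
    have hc : Continuous fun u : Fin N → EuclideanSpace ℝ (Fin m) => ∑ i, ‖u i - v k‖ ^ 2 := by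
      fun_prop
    have := (hc.tendsto v).comp hv
    simpa [hcons] using! this
  rw [hL'0] at hL'
  rw [tendsto_iff_norm_sub_tendsto_zero]
  have h5 : Tendsto (fun t => ‖x i t - v k‖ ^ 2) atTop (𝓝 0) :=
    squeeze_zero (fun t => sq_nonneg _) (fun t => Finset.single_le_sum
      (f := fun i => ‖x i t - v k‖ ^ 2) (fun i _ => sq_nonneg _) (Finset.mem_univ i)) hL'
  simpa using h5.sqrt
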